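/- Let $n\ge 1$, let $\mathfrak t=(t_1,\dots,t_n)$ and $T=(T_1,\dots,T_n)$ be real vectors with $t_1<\dots<t_n$, and for a function $f:\mathbb R\to\mathbb R$ write $\mathfrak f(\mathfrak t)=(f(t_1),\dots,f(t_n))$. Errors are measured by $\|T-\mathfrak f(\mathfrak t)\|_\infty=\max_i|T_i-f(t_i)|$. Let $r(s)=as+b$ be a line of least error for $(\mathfrak t,T)$ among all lines, and $E=\|T-\mathfrak r(\mathfrak t)\|_\infty$. The dataset $(\mathfrak t,T)$ is called *admissible* if $a<0$ and there are indices $i<j<m$ such that 1. $T_i-r(t_i)=r(t_j)-T_j=T_m-r(t_m)=E$; 2. $-E\le r(t_l)-T_l<E$ for every $l<i$ and every $l>m$; 3. $-E\le T_l-r(t_l)<E$ for every $i<l<m$. (This forces $n\ge 3$ and $E>0$.) Let $m_T=\min_i T_i$ and $M_T=\max_{i\ge 2}T_i$. Condition $\spadesuit$ says that $T_1=\max_i T_i$ and that there are indices $p<q$ with $T_p=m_T$ and $T_q=M_T$ (the second greatest value, counted with multiplicity, is attained after the minimum). **Theorem.** Let $(\mathfrak t,T)$ be admissible. (a) There is a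 best approximation to $(\mathfrak t,T)$ that is a genuine exponential, that is, there are $a,k,b\in\mathbb R$ with $a\neq0$ and $k\neq 0$ such that $f(s)=a\exp(ks)+b$ has strictly smaller error than every function $s\mapsto a'\exp(k's)+b'$ ($a',k',b'\in\mathbb R$) different from $f$, if and only if $\spadesuit$ does not hold. (b) For every $k\neq0$ there is exactly one pair $(a_k,b_k)\in\mathbb R^2$ for which $f_k(s)=a_k\exp(ks)+b_k$ has least error among all functions $s\mapsto a\exp(ks)+b$ with this exponent $k$. If $\spadesuit$ holds, then $$\lim_{k\to-\infty}\mathfrak f_k(\mathfrak t)=\mathfrak f_{-\infty}(\mathfrak t):=\Bigl(T_1-\tfrac{M_T-m_T}{2},\ \tfrac{M_T+m_T}{2},\dots,\tfrac{M_T+m_T}{2}\Bigr),$$ and every function $f(s)=a\exp(ks)+b$ with $a,k,b\in\mathbb R$ satisfies $\|T-\mathfrak f_{-\infty}(\mathfrak t)\|_\infty<\|T-\mathfrak f(\mathfrak t)\|_\infty$. -/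

import Mathlib

open Filter Topology

namespace ExpFit

/-- The vector `(a exp (k t₁) + b, …, a exp (k tₙ) + b)`. -/
noncomputable def expVec {ι : Type*} (t : ι → ℝ) (a k b : ℝ) : ι → ℝ :=
  fun i => a * Real.exp (k * t i) + b

/-- The vector `(a t₁ + b, …, a tₙ + b)`. -/
def lineVec {ι : Type*} (t : ι → ℝ) (a b : ℝ) : ι → ℝ :=
  fun i => a * t i + b

/-- The max-norm error of approximating the data vector `T` by the vector `v`
(finite families of reals carry the max-norm). -/
noncomputable def error {ι : Type*} [Fintype ι] (T v : ι → ℝ) : ℝ := ‖T - v‖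

/-- `s ↦ a s + b` is a best approximation to the data among all lines. -/
def IsBestLine {ι : Type*} [Fintype ι] (t T : ι → ℝ) (a b : ℝ) : Prop :=
  ∀ a' b' : ℝ, error T (lineVec t a b) ≤ error T (lineVec t a' b')

/-- `s ↦ a exp (k s) + b` is a best approximation to the data among all functions
`s ↦ a' exp (k s) + b'` with the same exponent `k`. -/
def IsBestFor {ι : Type*} [Fintype ι] (t T : ι → ℝ) (k a b : ℝ) : Prop :=
  ∀ a' b' : ℝ, error T (expVec t a k b) ≤ error T (expVec t a' k b')

/-- `s ↦ a exp (k s) + b` is the best approximation to the data: it is strictly better than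
every other function of the form `s ↦ a' exp (k' s) + b'`. -/
def IsBestApprox {ι : Type*} [Fintype ι] (t T : ι → ℝ) (a k b : ℝ) : Prop :=
  ∀ a' k' b' : ℝ,
    (fun s : ℝ => a' * Real.exp (k' * s) + b') ≠ (fun s : ℝ => a * Real.exp (k * s) + b) →
      error T (expVec t a k b) < error T (expVec t a' k' b')

/-- Admissible datasets: the best line `r(s) = a s + b` has `a < 0`, and its residuals attain
the norm with signs `+, -, +` at some `i < j < m`, with no `-` extremum outside `[i, m]` and no
`+` extremum strictly between `i` and `m`. -/
def Admissible {n : ℕ} (t T : Fin n → ℝ) : Prop :=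
  ∃ a b : ℝ, IsBestLine t T a b ∧ a < 0 ∧
    ∃ i j m : Fin n, i < j ∧ j < m ∧
      (T i - (a * t i + b) = error T (lineVec t a b) ∧
        (a * t j + b) - T j = error T (lineVec t a b) ∧
        T m - (a * t m + b) = error T (lineVec t a b)) ∧
      (∀ l, l < i ∨ m < l →
        -error T (lineVec t a b) ≤ (a * t l + b) - T l ∧
          (a * t l + b) - T l < error T (lineVec t a b)) ∧
      (∀ l, i < l → l < m →
        -error T (lineVec t a b) ≤ T l - (a * t l + b) ∧
          T l - (a * t l + b) < error T (lineVec t a b))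

/-- The greatest entry of `T`. -/
noncomputable def maxVal {n : ℕ} (T : Fin (n + 1) → ℝ) : ℝ := ⨆ i, T i

/-- The least entry of `T`. -/
noncomputable def minVal {n : ℕ} (T : Fin (n + 1) → ℝ) : ℝ := ⨅ i, T i

/-- The greatest of the entries of `T` other than the first one. When the first entry is the
greatest, this is the second greatest entry, counted with multiplicity. -/
noncomputable def secondVal {n : ℕ} (T : Fin (n + 1) → ℝ) : ℝ := ⨆ i : Fin n, T i.succ

/-- The first entry of `T` is its maximum, and the second greatest value is attained at
some index that comes after an index where the minimum is attained. -/
def Spade {n : ℕ} (T : Fin (n + 1) → ℝ) : Prop :=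
  T 0 = maxVal T ∧ ∃ p q : Fin (n + 1), p < q ∧ T p = minVal T ∧ T q = secondVal T

/-- The vector `(T₁ - (M - m) / 2, (M + m) / 2, …, (M + m) / 2)`, where `M` is the second
greatest value and `m` the minimum. -/
noncomputable def limitVec {n : ℕ} (T : Fin (n + 1) → ℝ) : Fin (n + 1) → ℝ :=
  fun i => if i = 0 then T 0 - (secondVal T - minVal T) / 2 else (secondVal T + minVal T) / 2

end ExpFit

/-! The engine is a one-turn property: if the curve with the larger exponent decreases (a line
counting as exponent `0`), then subtracting it from the other leaves a function whose derivative
changes sign at most once, from negative to positive (`lt_max_of_hasDerivAt`). Such a difference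
cannot be `≤ 0`, `≥ 0`, `≤ 0` at three successive points. Hence residual signs `+, -, +` on the best
line force every curve at least as good to be decreasing and convex (`exponent_neg_of_error_le`).
Perturbing the exponent while two well-chosen points stay fixed beats the best line
(`exists_exp_error_lt_line`), and shows that two equally good convex curves with different exponents
cannot both be optimal (`exists_error_lt_of_exponent_lt`).

Existence is a compactness argument (`exists_min_of_error_lt`). Negative exponents are compactified
by `z = exp k`: `z = 1` gives lines, already beaten, and `z = 0` gives the vectors `(x, y, …, y)`,
whose error is at least `(M - m) / 2` for `M = secondVal T`, `m = minVal T`. A minimum is therefore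
attained at a genuine exponential once some curve has error below `(M - m) / 2`. Without `Spade`
there is one: if `T 0 ≤ M`, a constant already has error at most `(M - m) / 2`, hence so does the
best line, which is beaten; otherwise every maximum precedes every minimum and a steep curve works
(`exists_error_lt_half_range`).

Under `Spade` the minimum precedes `M`, so a decreasing curve has error above `(M - m) / 2`, which
bounds the error of `limitVec`. The best curves for `k → -∞` equioscillate at three indices, can be
written down explicitly, and tend to `limitVec` (`tendsto_expVec_of_isBestFor`), so no curve is
optimal. -/

namespace ExpFit

/-! ### Max-norm error and its decrease under small perturbations. -/

section Error

variable {ι : Type*} [Fintype ι]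

theorem abs_le_error (T v : ι → ℝ) (l : ι) : |T l - v l| ≤ error T v :=
  norm_le_pi_norm (T - v) l

theorem error_nonneg (T v : ι → ℝ) : 0 ≤ error T v := norm_nonneg _

theorem error_le {T v : ι → ℝ} {e : ℝ} (he : 0 ≤ e) (h : ∀ l, |T l - v l| ≤ e) :
    error T v ≤ e :=
  (pi_norm_le_iff_of_nonneg he).2 h

theorem error_lt [Nonempty ι] {T v : ι → ℝ} {e : ℝ} (h : ∀ l, |T l - v l| < e) :
    error T v < e :=
  (pi_norm_lt_iff ((abs_nonneg _).trans_lt (h (Classical.arbitrary ι)))).2 h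

theorem continuous_error (T : ι → ℝ) : Continuous (error T) := by
  unfold error; fun_prop

/-- Moving an approximation in the direction of its residual at all extremal points
decreases the error. -/
theorem eventually_error_lt [Nonempty ι] {κ : Type*} {F : Filter κ} {T v : ι → ℝ}
    {h : κ → ι → ℝ} {e : ℝ} (hv : ∀ l, |T l - v l| ≤ e)
    (hlim : ∀ l, Tendsto (fun x => h x l) F (𝓝 (v l)))
    (hpos : ∀ l, T l - v l = e → ∀ᶠ x in F, v l < h x l)
    (hneg : ∀ l, v l - T l = e → ∀ᶠ x in F, h x l < v l) :
    ∀ᶠ x in F, error T (h x) < e := by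
  have key : ∀ l, ∀ᶠ x in F, |T l - h x l| < e := by
    intro l
    have h1 : ∀ᶠ x in F, T l - h x l < e := by
      rcases (le_of_abs_le (hv l)).lt_or_eq with hlt | heq
      · exact (tendsto_const_nhds.sub (hlim l)).eventually_lt_const hlt
      · filter_upwards [hpos l heq] with x hx using by linarith
    have h2 : ∀ᶠ x in F, h x l - T l < e := by
      rcases (neg_le_of_abs_le (hv l)).lt_or_eq with hlt | heq
      · exact ((hlim l).sub tendsto_const_nhds).eventually_lt_const (by linarith)
      · filter_upwards [hneg l (by linarith)] with x hx using by linarith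
    filter_upwards [h1, h2] with x hx1 hx2
    exact abs_lt.2 ⟨by linarith, hx1⟩
  filter_upwards [eventually_all.2 key] with x hx using error_lt hx

end Error

section Separation

variable {ι : Type*} [Finite ι]

/-- Serves to place a crossing point of two curves strictly between a data point and its neighbour,
so that the sign of their difference is strict at every data point. -/
theorem exists_lt_separating (t : ι → ℝ) (x : ℝ) : ∃ u < x, ∀ l, t l < x → t l < u := by
  have h : ∀ᶠ u in 𝓝[<] x, ∀ l, t l < x → t l < u := by
    refine eventually_all.2 fun l => ?_
    by_cases hl : t l < x
    · filter_upwards [Ioo_mem_nhdsLT hl] with u hu _ using hu.1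
    · exact Eventually.of_forall fun _ h => absurd h hl
  obtain ⟨u, hu, hux⟩ := (h.and self_mem_nhdsWithin).exists
  exact ⟨u, hux, hu⟩

theorem exists_gt_separating (t : ι → ℝ) (x : ℝ) : ∃ u > x, ∀ l, x < t l → u < t l := by
  have h : ∀ᶠ u in 𝓝[>] x, ∀ l, x < t l → u < t l := by
    refine eventually_all.2 fun l => ?_
    by_cases hl : x < t l
    · filter_upwards [Ioo_mem_nhdsGT hl] with u hu _ using hu.2
    · exact Eventually.of_forall fun _ h => absurd h hl
  obtain ⟨u, hu, hux⟩ := (h.and self_mem_nhdsWithin).exists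
  exact ⟨u, hux, hu⟩

end Separation

/-! ### Differences of curves turn at most once. -/

/-- A function whose derivative is a difference of exponentials changes direction at most once,
from decreasing to increasing. -/
theorem lt_max_of_hasDerivAt {d : ℝ → ℝ} {c₁ c₂ k₁ k₂ : ℝ}
    (hd : ∀ s, HasDerivAt d (c₂ * Real.exp (k₂ * s) - c₁ * Real.exp (k₁ * s)) s)
    (hc : 0 < c₂) (hk : k₁ < k₂) {s₁ s₂ s₃ : ℝ} (h₁₂ : s₁ < s₂) (h₂₃ : s₂ < s₃) :
    d s₂ < max (d s₁) (d s₃) := by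
  by_contra! hmax
  have hcont : Continuous d := continuous_iff_continuousAt.2 fun s => (hd s).continuousAt
  obtain ⟨x, hx, hx'⟩ := exists_hasDerivAt_eq_slope d _ h₁₂ hcont.continuousOn fun s _ => hd s
  obtain ⟨y, hy, hy'⟩ := exists_hasDerivAt_eq_slope d _ h₂₃ hcont.continuousOn fun s _ => hd s
  have h1 : 0 ≤ c₂ * Real.exp (k₂ * x) - c₁ * Real.exp (k₁ * x) := by
    rw [hx']
    exact div_nonneg (by linarith [le_max_left (d s₁) (d s₃)]) (by linarith)
  have h2 : c₂ * Real.exp (k₂ * y) - c₁ * Real.exp (k₁ * y) ≤ 0 := by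
    rw [hy']
    exact div_nonpos_of_nonpos_of_nonneg (by linarith [le_max_right (d s₁) (d s₃)]) (by linarith)
  -- With the positive factor `exp (k₁ s)` removed, the derivative becomes `c₂ exp ((k₂ - k₁) s) -
  -- c₁`, which is strictly increasing; it cannot be `≥ 0` at `x` and `≤ 0` at the later `y`.
  have e1 : Real.exp (k₂ * x) = Real.exp ((k₂ - k₁) * x) * Real.exp (k₁ * x) := by
    rw [← Real.exp_add]; ring_nf
  have e2 : Real.exp (k₂ * y) = Real.exp ((k₂ - k₁) * y) * Real.exp (k₁ * y) := by
    rw [← Real.exp_add]; ring_nf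
  rw [e1, ← mul_assoc, ← sub_mul] at h1
  rw [e2, ← mul_assoc, ← sub_mul] at h2
  have h1' := nonneg_of_mul_nonneg_left h1 (Real.exp_pos _)
  have h2' : c₂ * Real.exp ((k₂ - k₁) * y) - c₁ ≤ 0 := by
    by_contra! h
    exact absurd h2 (not_le.2 (mul_pos h (Real.exp_pos _)))
  have hxy : Real.exp ((k₂ - k₁) * x) < Real.exp ((k₂ - k₁) * y) :=
    Real.exp_lt_exp.2 (mul_lt_mul_of_pos_left (hx.2.trans hy.1) (by linarith))
  nlinarith

theorem hasDerivAt_exp_curve (a k b s : ℝ) :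
    HasDerivAt (fun s => a * Real.exp (k * s) + b) (a * k * Real.exp (k * s)) s := by
  refine ((((hasDerivAt_id s).const_mul k).exp.const_mul a).add_const b).congr_deriv ?_
  simp only [id]; ring

/-- The difference of two curves `a exp (k s) + b` with different exponents, the one with the
greater exponent decreasing. -/
theorem exp_sub_exp_lt_max {a₁ k₁ b₁ a₂ k₂ b₂ : ℝ} (h₂ : a₂ * k₂ < 0) (hk : k₁ < k₂)
    {s₁ s₂ s₃ : ℝ} (h₁₂ : s₁ < s₂) (h₂₃ : s₂ < s₃) :
    (a₁ * Real.exp (k₁ * s₂) + b₁) - (a₂ * Real.exp (k₂ * s₂) + b₂) <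
      max ((a₁ * Real.exp (k₁ * s₁) + b₁) - (a₂ * Real.exp (k₂ * s₁) + b₂))
        ((a₁ * Real.exp (k₁ * s₃) + b₁) - (a₂ * Real.exp (k₂ * s₃) + b₂)) := by
  refine lt_max_of_hasDerivAt (c₁ := -(a₁ * k₁)) (c₂ := -(a₂ * k₂))
    (d := fun s => (a₁ * Real.exp (k₁ * s) + b₁) - (a₂ * Real.exp (k₂ * s) + b₂))
    (fun s => ?_) (by linarith) hk h₁₂ h₂₃
  refine ((hasDerivAt_exp_curve a₁ k₁ b₁ s).sub (hasDerivAt_exp_curve a₂ k₂ b₂ s)).congr_deriv ?_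
  ring

/-- The derivative of a line is a multiple of `exp (0 * s)`, so here the line plays the curve with
the larger exponent; in `line_sub_exp_lt_max` it plays the one with the smaller. -/
theorem exp_sub_line_lt_max {a₁ k₁ b₁ a b : ℝ} (ha : a < 0) (hk : k₁ < 0)
    {s₁ s₂ s₃ : ℝ} (h₁₂ : s₁ < s₂) (h₂₃ : s₂ < s₃) :
    (a₁ * Real.exp (k₁ * s₂) + b₁) - (a * s₂ + b) <
      max ((a₁ * Real.exp (k₁ * s₁) + b₁) - (a * s₁ + b))
        ((a₁ * Real.exp (k₁ * s₃) + b₁) - (a * s₃ + b)) := by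
  refine lt_max_of_hasDerivAt (c₁ := -(a₁ * k₁)) (c₂ := -a) (k₁ := k₁) (k₂ := 0)
    (d := fun s => (a₁ * Real.exp (k₁ * s) + b₁) - (a * s + b))
    (fun s => ?_) (by linarith) hk h₁₂ h₂₃
  refine ((hasDerivAt_exp_curve a₁ k₁ b₁ s).sub
    (((hasDerivAt_id s).const_mul a).add_const b)).congr_deriv ?_
  rw [zero_mul, Real.exp_zero]; ring

theorem line_sub_exp_lt_max {a₁ k₁ b₁ a b : ℝ} (h₁ : a₁ * k₁ < 0) (hk : 0 < k₁)
    {s₁ s₂ s₃ : ℝ} (h₁₂ : s₁ < s₂) (h₂₃ : s₂ < s₃) :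
    (a * s₂ + b) - (a₁ * Real.exp (k₁ * s₂) + b₁) <
      max ((a * s₁ + b) - (a₁ * Real.exp (k₁ * s₁) + b₁))
        ((a * s₃ + b) - (a₁ * Real.exp (k₁ * s₃) + b₁)) := by
  refine lt_max_of_hasDerivAt (c₁ := -a) (c₂ := -(a₁ * k₁)) (k₁ := 0) (k₂ := k₁)
    (d := fun s => (a * s + b) - (a₁ * Real.exp (k₁ * s) + b₁))
    (fun s => ?_) (by linarith) hk h₁₂ h₂₃
  refine ((((hasDerivAt_id s).const_mul a).add_const b).sub
    (hasDerivAt_exp_curve a₁ k₁ b₁ s)).congr_deriv ?_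
  rw [zero_mul, Real.exp_zero]; ring

/-- Sign of a function with at most one change of direction, from decreasing to increasing,
and two zeros. -/
theorem sign_of_lt_max {d : ℝ → ℝ}
    (hd : ∀ ⦃s₁ s₂ s₃ : ℝ⦄, s₁ < s₂ → s₂ < s₃ → d s₂ < max (d s₁) (d s₃)) {u v : ℝ}
    (huv : u < v) (hu : d u = 0) (hv : d v = 0) (s : ℝ) :
    (u < s → s < v → d s < 0) ∧ (s < u → 0 < d s) ∧ (v < s → 0 < d s) := by
  refine ⟨fun h1 h2 => ?_, fun h => ?_, fun h => ?_⟩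
  · simpa [hu, hv] using hd h1 h2
  · simpa [hu, hv] using hd h huv
  · simpa [hu, hv] using hd huv h

/-! ### Curves through two fixed points, as functions of the exponent. -/

/-- The curve `s ↦ A exp (k s) + B` (a line, if `k = 0`) with value `0` at `u` and `1` at `v`. -/
noncomputable def unitCurve (k u v s : ℝ) : ℝ :=
  if k = 0 then (s - u) / (v - u)
  else (Real.exp (k * s) - Real.exp (k * u)) / (Real.exp (k * v) - Real.exp (k * u))

theorem exp_mul_sub_ne_zero {k u v : ℝ} (hk : k ≠ 0) (huv : u ≠ v) :
    Real.exp (k * v) - Real.exp (k * u) ≠ 0 := by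
  rw [sub_ne_zero]
  intro h
  exact huv (mul_left_cancel₀ hk (Real.exp_injective h)).symm

@[simp] theorem unitCurve_left (k u v : ℝ) : unitCurve k u v u = 0 := by
  simp [unitCurve]

theorem unitCurve_right {u v : ℝ} (k : ℝ) (huv : u ≠ v) : unitCurve k u v v = 1 := by
  unfold unitCurve
  split_ifs with hk
  · exact div_self (sub_ne_zero.2 huv.symm)
  · exact div_self (exp_mul_sub_ne_zero hk huv)

/-- At `k = 0`, dividing numerator and denominator by `k` turns both into difference quotients with
limits `s - u` and `v - u`. This makes lines the limits of exponential curves. -/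
theorem continuous_unitCurve {u v : ℝ} (huv : u ≠ v) (s : ℝ) :
    Continuous fun k => unitCurve k u v s := by
  refine continuous_iff_continuousAt.2 fun k => ?_
  rcases eq_or_ne k 0 with rfl | hk
  · have key : ∀ w : ℝ, Tendsto (fun k : ℝ => k⁻¹ * (Real.exp (k * w) - Real.exp (k * u)))
        (𝓝[≠] 0) (𝓝 (w - u)) := by
      intro w
      have h : HasDerivAt (fun k : ℝ => Real.exp (k * w) - Real.exp (k * u)) (w - u) 0 := by
        have := ((hasDerivAt_id (0 : ℝ)).mul_const w).exp.fun_sub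
          ((hasDerivAt_id (0 : ℝ)).mul_const u).exp
        simpa using this
      simpa using h.tendsto_slope_zero
    rw [continuousAt_iff_punctured_nhds]
    have h0 : unitCurve 0 u v s = (s - u) / (v - u) := by simp [unitCurve]
    rw [h0]
    refine ((key s).div (key v) (sub_ne_zero.2 huv.symm)).congr' ?_
    filter_upwards [self_mem_nhdsWithin] with k hk
    have hk : k ≠ 0 := hk
    simp only [unitCurve, hk, if_false]
    exact mul_div_mul_left _ _ (inv_ne_zero hk)
  · have : (fun k => unitCurve k u v s) =ᶠ[𝓝 k] fun k =>
        (Real.exp (k * s) - Real.exp (k * u)) / (Real.exp (k * v) - Real.exp (k * u)) := by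
      filter_upwards [isOpen_ne.mem_nhds hk] with x hx
      simp only [unitCurve, if_neg (show x ≠ 0 from hx)]
    refine ContinuousAt.congr ?_ this.symm
    exact ContinuousAt.div (by fun_prop) (by fun_prop) (exp_mul_sub_ne_zero hk huv)

theorem tendsto_exp_mul_atBot {x : ℝ} (hx : 0 < x) :
    Tendsto (fun k : ℝ => Real.exp (k * x)) atBot (𝓝 0) :=
  Real.tendsto_exp_atBot.comp (tendsto_id.atBot_mul_const hx)

theorem tendsto_unitCurve_atBot {u v s : ℝ} (huv : u < v) (hus : u < s) :
    Tendsto (fun k => unitCurve k u v s) atBot (𝓝 1) := by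
  have key : ∀ w, u < w → Tendsto (fun k : ℝ => Real.exp (k * (w - u)) - 1) atBot (𝓝 (-1)) := by
    intro w hw
    simpa using (tendsto_exp_mul_atBot (sub_pos.2 hw)).sub_const 1
  have h := (key s hus).div (key v huv) (by norm_num)
  rw [div_self (by norm_num)] at h
  refine h.congr' ?_
  -- Cancelling `exp (k u)` leaves a quotient whose two parts both tend to `-1`.
  filter_upwards [eventually_lt_atBot 0] with k hk
  have e : ∀ w, Real.exp (k * w) - Real.exp (k * u)
      = Real.exp (k * u) * (Real.exp (k * (w - u)) - 1) := by
    intro w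
    rw [mul_sub, mul_one, ← Real.exp_add]; ring_nf
  simp only [unitCurve, hk.ne, if_false, Pi.div_apply]
  rw [e, e, mul_div_mul_left _ _ (Real.exp_ne_zero _)]

/-- The coefficients of the exponential curve with exponent `k` through `(u, x)` and `(v, y)`. -/
theorem exists_interpolant {k u v : ℝ} (hk : k ≠ 0) (x y : ℝ) :
    ∃ a b : ℝ, ∀ s, a * Real.exp (k * s) + b = x + (y - x) * unitCurve k u v s := by
  refine ⟨(y - x) / (Real.exp (k * v) - Real.exp (k * u)),
    x - (y - x) / (Real.exp (k * v) - Real.exp (k * u)) * Real.exp (k * u), fun s => ?_⟩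
  simp only [unitCurve, hk, if_false]
  ring

theorem exp_curve_eq_unitCurve {k u v : ℝ} (hk : k ≠ 0) (huv : u ≠ v) (a b s : ℝ) :
    a * Real.exp (k * s) + b = (a * Real.exp (k * u) + b) +
      ((a * Real.exp (k * v) + b) - (a * Real.exp (k * u) + b)) * unitCurve k u v s := by
  have := exp_mul_sub_ne_zero hk huv
  simp only [unitCurve, hk, if_false]
  field_simp
  ring

theorem line_eq_unitCurve {u v : ℝ} (huv : u ≠ v) (a b s : ℝ) :
    a * s + b = (a * u + b) + ((a * v + b) - (a * u + b)) * unitCurve 0 u v s := by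
  have : v - u ≠ 0 := sub_ne_zero.2 huv.symm
  simp only [unitCurve, if_true]
  field_simp
  ring

theorem exp_curve_lt_of_lt {a k b : ℝ} (h : a * k < 0) {x y : ℝ} (hxy : x < y) :
    a * Real.exp (k * y) + b < a * Real.exp (k * x) + b := by
  rcases mul_neg_iff.1 h with ⟨ha, hk⟩ | ⟨ha, hk⟩
  · have := Real.exp_lt_exp.2 (mul_lt_mul_of_neg_left hxy hk)
    nlinarith
  · have := Real.exp_lt_exp.2 (mul_lt_mul_of_pos_left hxy hk)
    nlinarith

theorem mul_neg_of_exp_curve_lt {a k b x y : ℝ} (hxy : x < y)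
    (h : a * Real.exp (k * y) + b < a * Real.exp (k * x) + b) : a * k < 0 := by
  by_contra! h0
  rcases h0.lt_or_eq with h1 | h1
  · have := exp_curve_lt_of_lt (a := -a) (k := k) (b := -b) (by linarith) hxy
    linarith
  · rcases mul_eq_zero.1 h1.symm with rfl | rfl <;> simp at h

/-! ### Comparison with the best line and between different exponents. -/

/-- Every exponential curve that is as good as a decreasing line with residual signs `+, -, +`
is decreasing and convex. -/
theorem exponent_neg_of_error_le {ι : Type*} [Fintype ι] {t T : ι → ℝ} {a b E : ℝ} (ha : a < 0)
    {i j m : ι} (hij : t i < t j) (hjm : t j < t m) (hi : T i - (a * t i + b) = E)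
    (hj : (a * t j + b) - T j = E) (hm : T m - (a * t m + b) = E) {a' k' b' : ℝ}
    (h : error T (expVec t a' k' b') ≤ E) : k' < 0 ∧ 0 < a' := by
  have hb : ∀ l, |T l - (a' * Real.exp (k' * t l) + b')| ≤ E := fun l =>
    (abs_le_error T (expVec t a' k' b') l).trans h
  have fi := (abs_le.1 (hb i)).2
  have fj := (abs_le.1 (hb j)).1
  have fm := (abs_le.1 (hb m)).2
  have hr : a * t j < a * t i := mul_lt_mul_of_neg_left hij ha
  have hdec : a' * k' < 0 := mul_neg_of_exp_curve_lt (b := b') hij (by linarith)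
  rcases mul_neg_iff.1 hdec with ⟨h1, h2⟩ | ⟨h1, h2⟩
  · exact ⟨h2, h1⟩
  -- In the concave case, line minus curve would be `≤ 0`, `≥ 0`, `≤ 0` at `t i`, `t j`, `t m`,
  -- against the one-turn property.
  · have := line_sub_exp_lt_max (a := a) (b := b) (b₁ := b') hdec h2 hij hjm
    rcases lt_max_iff.1 this with h | h <;> linarith

/-- A decreasing line whose positive extremal residuals are outside, and whose negative ones are
inside some interval `(t i, t m)` with `t i < t j < t m` is not optimal. -/
theorem exists_exp_error_lt_line {ι : Type*} [Fintype ι] {t T : ι → ℝ} {a b E : ℝ} (ha : a < 0)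
    {i j m : ι} (hij : t i < t j) (hjm : t j < t m)
    (hE : ∀ l, |T l - (a * t l + b)| ≤ E)
    (hout : ∀ l, t l ≤ t i ∨ t m ≤ t l → (a * t l + b) - T l < E)
    (hin : ∀ l, t i < t l → t l < t m → T l - (a * t l + b) < E) :
    ∃ a' k' b' : ℝ, error T (expVec t a' k' b') < E := by
  have : Nonempty ι := ⟨i⟩
  -- The new curve meets the line at `u` and `v`, just inside `(t i, t m)`. For `k < 0` it lies
  -- below the line between them and above it outside, which is the direction of every extremal
  -- residual.
  obtain ⟨u, hu, hu'⟩ := exists_gt_separating t (t i)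
  obtain ⟨v, hv, hv'⟩ := exists_lt_separating t (t m)
  have huv : u < v := (hu' j hij).trans (hv' j hjm)
  set f : ℝ → ℝ := fun s => a * s + b with hf
  have hsign : ∀ k < 0, ∀ s,
      (u < s → s < v → f u + (f v - f u) * unitCurve k u v s - f s < 0) ∧
      (s < u → 0 < f u + (f v - f u) * unitCurve k u v s - f s) ∧
      (v < s → 0 < f u + (f v - f u) * unitCurve k u v s - f s) := by
    intro k hk s
    obtain ⟨a', b', hab⟩ := exists_interpolant (u := u) (v := v) hk.ne (f u) (f v)
    refine sign_of_lt_max (d := fun s => f u + (f v - f u) * unitCurve k u v s - f s)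
      (fun s₁ s₂ s₃ h12 h23 => ?_) huv ?_ ?_ s
    · simp only [← hab]
      exact exp_sub_line_lt_max ha hk h12 h23
    · simp
    · simp [unitCurve_right k huv.ne]
  have hev : ∀ᶠ k in 𝓝[<] (0 : ℝ),
      error T (fun l => f u + (f v - f u) * unitCurve k u v (t l)) < E := by
    refine eventually_error_lt (v := fun l => f (t l)) hE (fun l => ?_) (fun l hl => ?_)
      fun l hl => ?_
    · have hc : Continuous fun k => f u + (f v - f u) * unitCurve k u v (t l) :=
        continuous_const.add (continuous_const.mul (continuous_unitCurve huv.ne (t l)))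
      have := (hc.tendsto 0).mono_left (nhdsWithin_le_nhds (s := Set.Iio 0))
      rwa [← line_eq_unitCurve huv.ne a b (t l)] at this
    · have hlout : t l ≤ t i ∨ t m ≤ t l := by
        by_contra! hcon
        exact (hin l hcon.1 hcon.2).ne hl
      filter_upwards [self_mem_nhdsWithin] with k hk
      rcases hlout with h | h
      · linarith [(hsign k hk (t l)).2.1 (h.trans_lt hu)]
      · linarith [(hsign k hk (t l)).2.2 (hv.trans_le h)]
    · have hlin : t i < t l ∧ t l < t m := by
        by_contra! hcon
        refine (hout l ?_).ne hl
        by_cases h : t i < t l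
        · exact Or.inr (hcon h)
        · exact Or.inl (not_lt.1 h)
      filter_upwards [self_mem_nhdsWithin] with k hk
      linarith [(hsign k hk (t l)).1 (hu' l hlin.1) (hv' l hlin.2)]
  obtain ⟨k, hk, hk0⟩ := (hev.and self_mem_nhdsWithin).exists
  have hk0 : k < 0 := hk0
  obtain ⟨a', b', hab⟩ := exists_interpolant (u := u) (v := v) hk0.ne (f u) (f v)
  refine ⟨a', k, b', ?_⟩
  convert hk using 2
  ext l
  exact hab _

/-- Of two decreasing convex exponential curves with different exponents that fit the data equally
well, the one with the lower exponent can be improved. -/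
theorem exists_error_lt_of_exponent_lt {n : ℕ} {t T : Fin (n + 1) → ℝ} (ht : StrictMono t)
    {i j m : Fin (n + 1)} (hij : i < j) (hjm : j < m) {a₁ k₁ b₁ a₂ k₂ b₂ : ℝ}
    (ha₁ : 0 < a₁) (ha₂ : 0 < a₂) (hk : k₁ < k₂) (hk₂ : k₂ < 0)
    (h : error T (expVec t a₂ k₂ b₂) ≤ error T (expVec t a₁ k₁ b₁)) :
    ∃ a k b : ℝ, error T (expVec t a k b) < error T (expVec t a₁ k₁ b₁) := by
  set e := error T (expVec t a₁ k₁ b₁) with he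
  set f : ℝ → ℝ := fun s => a₁ * Real.exp (k₁ * s) + b₁ with hf
  have hfe : ∀ l, |T l - f (t l)| ≤ e := fun l => abs_le_error T (expVec t a₁ k₁ b₁) l
  have hge : ∀ l, |T l - (a₂ * Real.exp (k₂ * t l) + b₂)| ≤ e := fun l =>
    (abs_le_error T (expVec t a₂ k₂ b₂) l).trans h
  -- Extremal residuals `+, -, +` on the lower-exponent curve would make its difference from the
  -- other curve `≤ 0`, `≥ 0`, `≤ 0`.
  have hPNP : ∀ x y z : Fin (n + 1), x < y → y < z → T x - f (t x) = e → f (t y) - T y = e →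
      T z - f (t z) = e → False := by
    intro x y z hxy hyz hx hy hz
    have h1 := (abs_le.1 (hge x)).2
    have h2 := (abs_le.1 (hge y)).1
    have h3 := (abs_le.1 (hge z)).2
    have := exp_sub_exp_lt_max (a₁ := a₁) (b₁ := b₁) (b₂ := b₂)
      (mul_neg_of_pos_of_neg ha₂ hk₂) hk (ht hxy) (ht hyz)
    simp only [hf] at hx hy hz
    rcases lt_max_iff.1 this with h | h <;> linarith
  have he0 : 0 < e := by
    refine lt_of_le_of_ne (error_nonneg _ _) fun h0 => ?_
    have hz : ∀ l, T l = f (t l) := fun l => by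
      have := hfe l
      rw [← h0] at this
      exact sub_eq_zero.1 (abs_nonpos_iff.1 this)
    -- With error zero every index counts as an extremum of both signs, so any three indices give
    -- the forbidden pattern.
    refine hPNP i j m hij hjm ?_ ?_ ?_ <;> rw [← hz, ← h0, sub_self]
  by_cases hP : ∃ l, T l - f (t l) = e
  swap
  · have hev : ∀ᶠ x in 𝓝[>] (0 : ℝ), error T (fun l => f (t l) - x) < e := by
      refine eventually_error_lt (v := fun l => f (t l)) hfe (fun l => ?_)
        (fun l hl => absurd ⟨l, hl⟩ hP) fun l _ => ?_
      · have : Tendsto (fun x : ℝ => f (t l) - x) (𝓝 0) (𝓝 (f (t l) - 0)) :=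
          tendsto_const_nhds.sub tendsto_id
        rw [sub_zero] at this
        exact this.mono_left nhdsWithin_le_nhds
      · filter_upwards [self_mem_nhdsWithin] with x hx
        have hx : 0 < x := hx
        linarith
    obtain ⟨x, hx⟩ := hev.exists
    refine ⟨a₁, k₁, b₁ - x, ?_⟩
    convert hx using 2
    ext l
    simp only [expVec, hf]
    ring
  classical
  let P : Finset (Fin (n + 1)) := Finset.univ.filter fun l => T l - f (t l) = e
  have hPne : P.Nonempty := by
    obtain ⟨l, hl⟩ := hP
    exact ⟨l, by simpa [P] using hl⟩
  have hmin : T (P.min' hPne) - f (t (P.min' hPne)) = e := by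
    simpa [P] using P.min'_mem hPne
  have hmax : T (P.max' hPne) - f (t (P.max' hPne)) = e := by
    simpa [P] using P.max'_mem hPne
  have hPmem : ∀ l, T l - f (t l) = e → P.min' hPne ≤ l ∧ l ≤ P.max' hPne := fun l hl =>
    have hl' : l ∈ P := by simpa [P] using hl
    ⟨P.min'_le l hl', P.le_max' l hl'⟩
  generalize P.min' hPne = p at hmin hPmem
  generalize P.max' hPne = q at hmax hPmem
  have hpq : p ≤ q := (hPmem p hmin).2
  -- Positive extrema lie in `[p, q]`, negative ones outside. Raising the exponent with the values
  -- at `u` and `v` fixed lifts the curve between these points and lowers it elsewhere.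
  obtain ⟨u, hu, hu'⟩ := exists_lt_separating t (t p)
  obtain ⟨v, hv, hv'⟩ := exists_gt_separating t (t q)
  have huv : u < v := hu.trans_le ((ht.monotone hpq).trans hv.le)
  have hsign : ∀ k, k₁ < k → k < 0 → ∀ s,
      (u < s → s < v → f s - (f u + (f v - f u) * unitCurve k u v s) < 0) ∧
      (s < u → 0 < f s - (f u + (f v - f u) * unitCurve k u v s)) ∧
      (v < s → 0 < f s - (f u + (f v - f u) * unitCurve k u v s)) := by
    intro k hk1 hk0 s
    obtain ⟨a', b', hab⟩ := exists_interpolant (u := u) (v := v) hk0.ne (f u) (f v)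
    have hneg : a' * k < 0 := by
      refine mul_neg_of_exp_curve_lt (b := b') huv ?_
      rw [hab, hab, unitCurve_right k huv.ne, unitCurve_left]
      have : f v < f u := exp_curve_lt_of_lt (mul_neg_of_pos_of_neg ha₁ (hk1.trans hk0)) huv
      linarith
    refine sign_of_lt_max (d := fun s => f s - (f u + (f v - f u) * unitCurve k u v s))
      (fun s₁ s₂ s₃ h12 h23 => ?_) huv ?_ ?_ s
    · simp only [← hab]
      exact exp_sub_exp_lt_max hneg hk1 h12 h23
    · simp
    · simp [unitCurve_right k huv.ne]
  have hIoo : Set.Ioo k₁ 0 ∈ 𝓝[>] k₁ := Ioo_mem_nhdsGT (hk.trans hk₂)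
  have hev : ∀ᶠ k in 𝓝[>] k₁,
      error T (fun l => f u + (f v - f u) * unitCurve k u v (t l)) < e := by
    refine eventually_error_lt (v := fun l => f (t l)) hfe (fun l => ?_) (fun l hl => ?_)
      fun l hl => ?_
    · have hc : Continuous fun k => f u + (f v - f u) * unitCurve k u v (t l) :=
        continuous_const.add (continuous_const.mul (continuous_unitCurve huv.ne (t l)))
      have := (hc.tendsto k₁).mono_left (nhdsWithin_le_nhds (s := Set.Ioi k₁))
      rwa [← exp_curve_eq_unitCurve (hk.trans hk₂).ne huv.ne a₁ b₁ (t l)] at this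
    · have hl' := hPmem l hl
      filter_upwards [hIoo] with k hk
      linarith [(hsign k hk.1 hk.2 (t l)).1 (hu.trans_le (ht.monotone hl'.1))
        ((ht.monotone hl'.2).trans_lt hv)]
    · have hlp : l ≠ p := by rintro rfl; linarith
      have hlq : l ≠ q := by rintro rfl; linarith
      filter_upwards [hIoo] with k hk
      rcases hlp.lt_or_gt with h | h
      · linarith [(hsign k hk.1 hk.2 (t l)).2.1 (hu' l (ht h))]
      · rcases hlq.lt_or_gt with h' | h'
        · exact (hPNP p l q h h' hmin hl hmax).elim
        · linarith [(hsign k hk.1 hk.2 (t l)).2.2 (hv' l (ht h'))]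
  obtain ⟨k, hk', hkm⟩ := (hev.and hIoo).exists
  obtain ⟨a', b', hab⟩ := exists_interpolant (u := u) (v := v) hkm.2.ne (f u) (f v)
  refine ⟨a', k, b', ?_⟩
  convert hk' using 2
  ext l
  exact hab _

/-! ### Existence and uniqueness for a fixed exponent. -/

/-- For a fixed exponent there is a best approximation. -/
theorem exists_isBestFor {ι : Type*} [Fintype ι] (t T : ι → ℝ) (k : ℝ) :
    ∃ a b : ℝ, IsBestFor t T k a b := by
  let V : Submodule ℝ (ι → ℝ) :=
    Submodule.span ℝ {fun i => Real.exp (k * t i), fun _ => (1 : ℝ)}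
  have : FiniteDimensional ℝ V := FiniteDimensional.span_of_finite ℝ (by simp)
  have hV : ∀ a b, expVec t a k b ∈ V := fun a b =>
    Submodule.mem_span_pair.2 ⟨a, b, by ext i; simp [expVec]⟩
  obtain ⟨y, hy, hd⟩ := V.closed_of_finiteDimensional.exists_infDist_eq_dist ⟨0, V.zero_mem⟩ T
  obtain ⟨a, b, rfl⟩ := Submodule.mem_span_pair.1 hy
  refine ⟨a, b, fun a' b' => ?_⟩
  have h := Metric.infDist_le_dist_of_mem (x := T) (hV a' b')
  rw [hd, dist_eq_norm, dist_eq_norm] at h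
  have e : expVec t a k b = (a • fun i => Real.exp (k * t i)) + b • fun _ => (1 : ℝ) := by
    ext i; simp [expVec]
  rwa [← e] at h

/-- For a fixed exponent the best approximation is unique. -/
theorem IsBestFor.unique {ι : Type*} [Fintype ι] {t T : ι → ℝ} (ht : Function.Injective t)
    [Nontrivial ι] {k a b a' b' : ℝ} (hk : k ≠ 0) (h : IsBestFor t T k a b)
    (h' : IsBestFor t T k a' b') : a = a' ∧ b = b' := by
  by_contra hne
  set e := error T (expVec t a k b) with he
  have he' : error T (expVec t a' k b') = e := le_antisymm (h' a b) (h a' b')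
  have hexp : ∀ l l', Real.exp (k * t l) = Real.exp (k * t l') → l = l' := fun l l' hl =>
    ht (mul_left_cancel₀ hk (Real.exp_injective hl))
  have hsub : ∀ l l', expVec t a k b l = expVec t a' k b' l →
      expVec t a k b l' = expVec t a' k b' l' → l = l' := by
    intro l l' h1 h2
    by_contra hll
    simp only [expVec] at h1 h2
    have h3 : (a - a') * (Real.exp (k * t l) - Real.exp (k * t l')) = 0 := by linarith
    rcases mul_eq_zero.1 h3 with h4 | h4
    · have h4 := sub_eq_zero.1 h4
      subst h4
      exact hne ⟨rfl, by linarith⟩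
    · exact hll (hexp l l' (sub_eq_zero.1 h4))
  -- Where the midpoint has an extremal residual the two optima agree, and distinct curves agree at
  -- one data point at most. So extrema of only one sign occur, and a vertical shift improves the
  -- midpoint.
  set c : ι → ℝ := expVec t ((a + a') / 2) k ((b + b') / 2) with hc
  have hcmid : ∀ l, c l = (expVec t a k b l + expVec t a' k b' l) / 2 := fun l => by
    simp only [hc, expVec]; ring
  have hb1 : ∀ l, |T l - expVec t a k b l| ≤ e := fun l => abs_le_error _ _ l
  have hb2 : ∀ l, |T l - expVec t a' k b' l| ≤ e := fun l => he' ▸ abs_le_error _ _ l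
  have hce : ∀ l, |T l - c l| ≤ e := fun l => by
    have h1 := abs_le.1 (hb1 l)
    have h2 := abs_le.1 (hb2 l)
    rw [hcmid, abs_le]
    constructor <;> linarith
  have hpos : ∀ l, T l - c l = e → expVec t a k b l = expVec t a' k b' l := fun l hl => by
    have h1 := abs_le.1 (hb1 l)
    have h2 := abs_le.1 (hb2 l)
    rw [hcmid] at hl
    linarith
  have hneg : ∀ l, c l - T l = e → expVec t a k b l = expVec t a' k b' l := fun l hl => by
    have h1 := abs_le.1 (hb1 l)
    have h2 := abs_le.1 (hb2 l)
    rw [hcmid] at hl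
    linarith
  have he0 : 0 < e := by
    refine lt_of_le_of_ne (error_nonneg _ _) fun h0 => ?_
    obtain ⟨l, l', hll⟩ := exists_pair_ne ι
    have hz : ∀ l, T l - c l = e := fun l => by
      have := hce l
      rw [← h0] at this ⊢
      exact abs_nonpos_iff.1 this
    exact hll (hsub l l' (hpos l (hz l)) (hpos l' (hz l')))
  have hlim : ∀ (σ : ℝ) l, Tendsto (fun x : ℝ => c l + σ * x) (𝓝[>] 0) (𝓝 (c l)) := by
    intro σ l
    have : Tendsto (fun x : ℝ => c l + σ * x) (𝓝 0) (𝓝 (c l + σ * 0)) :=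
      tendsto_const_nhds.add (tendsto_const_nhds.mul tendsto_id)
    rw [mul_zero, add_zero] at this
    exact this.mono_left nhdsWithin_le_nhds
  have hfin : ∀ σ : ℝ, ¬ ∀ᶠ x in 𝓝[>] (0 : ℝ), error T (fun l => c l + σ * x) < e := by
    intro σ hev
    obtain ⟨x, hx⟩ := hev.exists
    have e : expVec t ((a + a') / 2) k ((b + b') / 2 + σ * x) = fun l => c l + σ * x := by
      ext l
      simp only [hc, expVec]
      ring
    exact (e ▸ h ((a + a') / 2) ((b + b') / 2 + σ * x)).not_gt hx
  by_cases hP : ∃ l, T l - c l = e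
  · obtain ⟨l₀, hl₀⟩ := hP
    refine hfin 1 (eventually_error_lt hce (hlim 1) (fun l _ => ?_) fun l hl => ?_)
    · filter_upwards [self_mem_nhdsWithin] with x hx
      have hx : 0 < x := hx
      linarith
    · have := hsub l l₀ (hneg l hl) (hpos l₀ hl₀)
      subst this
      linarith
  · refine hfin (-1) (eventually_error_lt hce (hlim (-1)) (fun l hl => absurd ⟨l, hl⟩ hP)
      fun l _ => ?_)
    filter_upwards [self_mem_nhdsWithin] with x hx
    have hx : 0 < x := hx
    linarith

/-! ### Compactification of the negative exponents. -/

/-- `unitCurve (log z)` at the data points, with its limit at `z = 0`. -/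
noncomputable def unitVec {n : ℕ} (t : Fin (n + 1) → ℝ) (z : ℝ) (l : Fin (n + 1)) : ℝ :=
  if z ≤ 0 then (if l = 0 then 0 else 1)
  else unitCurve (Real.log z) (t 0) (t (Fin.last n)) (t l)

theorem continuousOn_unitVec {n : ℕ} {t : Fin (n + 1) → ℝ} (ht : StrictMono t) (hn : 0 < n)
    (l : Fin (n + 1)) : ContinuousOn (fun z => unitVec t z l) (Set.Ici 0) := by
  have h0N : t 0 < t (Fin.last n) := ht (by rw [Fin.lt_def]; simpa using hn)
  intro z hz
  rcases (show (0 : ℝ) ≤ z from hz).eq_or_lt with rfl | hz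
  · rw [← continuousWithinAt_Ioi_iff_Ici]
    have hev : (fun z => unitCurve (Real.log z) (t 0) (t (Fin.last n)) (t l)) =ᶠ[𝓝[>] 0]
        fun z => unitVec t z l := by
      filter_upwards [self_mem_nhdsWithin] with z hz
      have hz : 0 < z := hz
      simp [unitVec, hz]
    refine Tendsto.congr' hev ?_
    rcases eq_or_ne l 0 with rfl | hl
    · simp [unitVec]
    · simpa [unitVec, hl, Function.comp_def] using (tendsto_unitCurve_atBot h0N
        (ht (Fin.pos_iff_ne_zero.2 hl))).comp Real.tendsto_log_nhdsGT_zero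
  · refine ContinuousAt.continuousWithinAt ?_
    have hev : (fun z => unitCurve (Real.log z) (t 0) (t (Fin.last n)) (t l)) =ᶠ[𝓝 z]
        fun z => unitVec t z l := by
      filter_upwards [lt_mem_nhds hz] with z hz
      simp [unitVec, hz]
    refine ContinuousAt.congr ?_ hev
    exact (continuous_unitCurve h0N.ne (t l)).continuousAt.comp (Real.continuousAt_log (ne_of_gt hz))

/-- If some exponential curve is better than all lines and all limits of exponential curves for
exponents tending to `-∞`, then there is a best curve among those with negative exponent. -/
theorem exists_min_of_error_lt {n : ℕ} {t T : Fin (n + 1) → ℝ} (ht : StrictMono t) (hn : 0 < n)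
    {a₀ k₀ b₀ E : ℝ} (hk₀ : k₀ < 0) (h₀ : error T (expVec t a₀ k₀ b₀) < E)
    (hline : ∀ a b, E ≤ error T (lineVec t a b))
    (hstep : ∀ x y, error T (expVec t a₀ k₀ b₀) < error T (fun l => if l = 0 then x else y)) :
    ∃ a k b : ℝ, error T (expVec t a k b) < E ∧
      ∀ a' k' b' : ℝ, k' < 0 → error T (expVec t a k b) ≤ error T (expVec t a' k' b') := by
  have h0N : t 0 < t (Fin.last n) := ht (by rw [Fin.lt_def]; simpa using hn)
  -- Coordinates are `exp k` and the values at the first and last data points; an error of at most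
  -- `E` confines those values to these intervals.
  let K : Set (ℝ × ℝ × ℝ) := Set.Icc 0 1 ×ˢ (Set.Icc (T 0 - E) (T 0 + E) ×ˢ
    Set.Icc (T (Fin.last n) - E) (T (Fin.last n) + E))
  let F : ℝ × ℝ × ℝ → ℝ := fun w =>
    error T (fun l => w.2.1 + (w.2.2 - w.2.1) * unitVec t w.1 l)
  have hK : IsCompact K := isCompact_Icc.prod (isCompact_Icc.prod isCompact_Icc)
  have hF : ContinuousOn F K := by
    refine (continuous_error T).comp_continuousOn (continuousOn_pi.2 fun l => ?_)
    have h1 : ContinuousOn (fun w : ℝ × ℝ × ℝ => unitVec t w.1 l) K :=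
      (continuousOn_unitVec ht hn l).comp continuousOn_fst fun w hw => hw.1.1
    fun_prop
  have hmem : ∀ a k b : ℝ, k < 0 → error T (expVec t a k b) ≤ E →
      ∃ w ∈ K, F w = error T (expVec t a k b) := by
    intro a k b hk he
    refine ⟨(Real.exp k, expVec t a k b 0, expVec t a k b (Fin.last n)), ⟨⟨?_, ?_⟩, ?_, ?_⟩, ?_⟩
    · exact (Real.exp_pos k).le
    · exact Real.exp_le_one_iff.2 hk.le
    · have := abs_le.1 ((abs_le_error T (expVec t a k b) 0).trans he)
      constructor <;> simp only <;> linarith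
    · have := abs_le.1 ((abs_le_error T (expVec t a k b) (Fin.last n)).trans he)
      constructor <;> simp only <;> linarith
    · simp only [F]
      congr 1
      ext l
      simp only [unitVec, Real.exp_pos k, not_le.2, if_false, Real.log_exp, expVec]
      exact (exp_curve_eq_unitCurve hk.ne h0N.ne a b (t l)).symm
  obtain ⟨w₀, hw₀, hFw₀⟩ := hmem a₀ k₀ b₀ hk₀ h₀.le
  obtain ⟨⟨z, x, y⟩, hw, hmin⟩ := hK.exists_isMinOn ⟨w₀, hw₀⟩ hF
  have hle : F (z, x, y) ≤ error T (expVec t a₀ k₀ b₀) := hFw₀ ▸ hmin hw₀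
  have hz0 : 0 < z := by
    refine lt_of_le_of_ne hw.1.1 fun h => (hstep x y).not_ge ?_
    have e : (fun l : Fin (n + 1) => if l = 0 then x else y) =
        fun l => x + (y - x) * unitVec t z l := by
      ext l
      rw [← h]
      by_cases hl : l = 0 <;> simp [unitVec, hl]
    rw [e]
    exact hle
  have hz1 : z < 1 := by
    refine lt_of_le_of_ne hw.1.2 fun h => ?_
    have h : z = 1 := h
    subst h
    refine (h₀.trans_le (hline ((y - x) / (t (Fin.last n) - t 0))
      (x - (y - x) / (t (Fin.last n) - t 0) * t 0))).not_ge ?_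
    have e : lineVec t ((y - x) / (t (Fin.last n) - t 0))
        (x - (y - x) / (t (Fin.last n) - t 0) * t 0) =
        fun l => x + (y - x) * unitVec t 1 l := by
      ext l
      simp only [unitVec, zero_lt_one, not_le.2, if_false, Real.log_one, unitCurve, if_true,
        lineVec]
      ring
    rw [e]
    exact hle
  have hk : Real.log z < 0 := Real.log_neg hz0 hz1
  obtain ⟨a, b, hab⟩ := exists_interpolant (u := t 0) (v := t (Fin.last n)) hk.ne x y
  have hFe : F (z, x, y) = error T (expVec t a (Real.log z) b) := by
    simp only [F]
    congr 1
    ext l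
    simp only [unitVec, hz0, not_le.2, if_false, expVec]
    exact (hab _).symm
  refine ⟨a, Real.log z, b, hFe ▸ hle.trans_lt h₀, fun a' k' b' hk' => ?_⟩
  rcases le_total (error T (expVec t a' k' b')) E with h | h
  · obtain ⟨w, hw, hFw⟩ := hmem a' k' b' hk' h
    rw [← hFe, ← hFw]
    exact hmin hw
  · exact ((hFe ▸ hle).trans h₀.le).trans h

/-! ### Steep curves: exponents tending to `-∞`. -/

/-- If in `T` without its first entry all greatest entries precede all least entries, then some
exponential curve is better than every vector `(x, y, …, y)`. -/
theorem exists_error_lt_half_range {n : ℕ} {t T : Fin (n + 1) → ℝ} (ht : StrictMono t)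
    {m M : ℝ} (hM : M < T 0) (hmM : m < M) (hrange : ∀ l, l ≠ 0 → m ≤ T l ∧ T l ≤ M)
    {p₀ : Fin (n + 1)} (hp₀ : T p₀ = m)
    (hpq : ∀ p q, T p = m → T q = M → q ≤ p) :
    ∃ a k b : ℝ, k < 0 ∧ error T (expVec t a k b) < (M - m) / 2 := by
  classical
  let P : Finset (Fin (n + 1)) := Finset.univ.filter fun l => T l = m
  have hPne : P.Nonempty := ⟨p₀, by simpa [P] using hp₀⟩
  have hp : T (P.min' hPne) = m := by simpa [P] using P.min'_mem hPne
  have hpmin : ∀ l, T l = m → P.min' hPne ≤ l := fun l hl => P.min'_le l (by simpa [P] using hl)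
  generalize P.min' hPne = p at hp hpmin
  have hp0 : 0 < p := Fin.pos_iff_ne_zero.2 (by rintro rfl; linarith)
  -- The curve passes through `(t 0, T 0)` and `(w, c)`, with `w` just before the first minimum.
  -- Being decreasing, it is above `c` at all maxima and below `c` at all minima, which beats its
  -- limit `(T 0, c, …, c)`.
  obtain ⟨w, hw, hw'⟩ := exists_lt_separating t (t p)
  have h0w : t 0 < w := hw' 0 (ht hp0)
  set c := (M + m) / 2 with hc
  have hev : ∀ᶠ k in atBot, error T (fun l => T 0 + (c - T 0) * unitCurve k (t 0) w (t l)) <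
      (M - m) / 2 := by
    have hcurve : ∀ k < 0, ∀ x y, x < y →
        T 0 + (c - T 0) * unitCurve k (t 0) w y < T 0 + (c - T 0) * unitCurve k (t 0) w x := by
      intro k hk x y hxy
      obtain ⟨a, b, hab⟩ := exists_interpolant (u := t 0) (v := w) hk.ne (T 0) c
      rw [← hab, ← hab]
      refine exp_curve_lt_of_lt (mul_neg_of_exp_curve_lt (b := b) h0w ?_) hxy
      rw [hab, hab, unitCurve_left, unitCurve_right k h0w.ne]
      linarith
    have hval : ∀ k, T 0 + (c - T 0) * unitCurve k (t 0) w w = c := fun k => by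
      rw [unitCurve_right k h0w.ne]; ring
    refine eventually_error_lt (v := fun l => if l = 0 then T 0 else c) (fun l => ?_)
      (fun l => ?_) (fun l hl => ?_) fun l hl => ?_
    · by_cases h : l = 0
      · simp only [h, if_true, sub_self, abs_zero]; linarith
      · have := hrange l h
        simp only [h, if_false]
        rw [abs_le]
        constructor <;> linarith
    · by_cases h : l = 0
      · simp [h]
      · simpa [h] using ((tendsto_unitCurve_atBot h0w
          (ht (Fin.pos_iff_ne_zero.2 h))).const_mul (c - T 0)).const_add (T 0)
    · by_cases h : l = 0
      · simp only [h, if_true, sub_self] at hl; linarith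
      · simp only [h, if_false] at hl ⊢
        have hlM : T l = M := by linarith
        have hlp : l < p := lt_of_le_of_ne (hpq p l hp hlM) (by rintro rfl; linarith)
        filter_upwards [eventually_lt_atBot 0] with k hk
        have := hcurve k hk _ _ (hw' l (ht hlp))
        rwa [hval] at this
    · by_cases h : l = 0
      · simp only [h, if_true, sub_self] at hl; linarith
      · simp only [h, if_false] at hl ⊢
        have hlp : p ≤ l := hpmin l (by linarith)
        filter_upwards [eventually_lt_atBot 0] with k hk
        have := hcurve k hk _ _ (hw.trans_le (ht.monotone hlp))
        rwa [hval] at this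
  obtain ⟨k, hk, hk0⟩ := (hev.and (eventually_lt_atBot 0)).exists
  obtain ⟨a, b, hab⟩ := exists_interpolant (u := t 0) (v := w) hk0.ne (T 0) c
  refine ⟨a, k, b, hk0, ?_⟩
  convert hk using 2
  ext l
  exact hab _

/-- If in `T` without its first entry some least entry precedes some greatest entry, then the best
approximations for the exponents `k → -∞` converge. -/
theorem tendsto_expVec_of_isBestFor {n : ℕ} {t T : Fin (n + 1) → ℝ} (ht : StrictMono t)
    {m M : ℝ} (hM : M < T 0) (hmM : m ≤ M) (hrange : ∀ l, l ≠ 0 → m ≤ T l ∧ T l ≤ M)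
    {p₀ q₀ : Fin (n + 1)} (hp₀ : T p₀ = m) (hq₀ : T q₀ = M) (hpq₀ : p₀ < q₀) {a b : ℝ → ℝ}
    (hab : ∀ k < 0, IsBestFor t T k (a k) (b k)) :
    Tendsto (fun k => expVec t (a k) k (b k)) atBot
      (𝓝 fun l => if l = 0 then T 0 - (M - m) / 2 else (M + m) / 2) := by
  classical
  obtain ⟨p, hp, hpmin⟩ : ∃ p, T p = m ∧ ∀ l, T l = m → p ≤ l := by
    let P : Finset (Fin (n + 1)) := Finset.univ.filter fun l => T l = m
    have hPne : P.Nonempty := ⟨p₀, by simpa [P] using hp₀⟩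
    exact ⟨P.min' hPne, by simpa [P] using P.min'_mem hPne,
      fun l hl => P.min'_le l (by simpa [P] using hl)⟩
  obtain ⟨q, hq, hqmax⟩ : ∃ q, T q = M ∧ ∀ l, T l = M → l ≤ q := by
    let P : Finset (Fin (n + 1)) := Finset.univ.filter fun l => T l = M
    have hPne : P.Nonempty := ⟨q₀, by simpa [P] using hq₀⟩
    exact ⟨P.max' hPne, by simpa [P] using P.max'_mem hPne,
      fun l hl => P.le_max' l (by simpa [P] using hl)⟩
  have hpq : p < q := ((hpmin _ hp₀).trans_lt hpq₀).trans_le (hqmax _ hq₀)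
  have hp0 : 0 < p := Fin.pos_iff_ne_zero.2 (by rintro rfl; linarith)
  let ψ : Fin (n + 1) → ℝ → ℝ := fun l k => Real.exp (k * (t l - t 0))
  -- `A`, `B` and `e` solve the equioscillation equations: residual `e` at `0` and `q`, and `-e` at
  -- `p`, where `p` is the first minimum and `q` the last occurrence of `M`.
  let A : ℝ → ℝ := fun k => (T 0 - M) / (1 - ψ q k)
  let e : ℝ → ℝ := fun k => (M - m) / 2 + A k * (ψ p k - ψ q k) / 2
  let B : ℝ → ℝ := fun k => M - e k - A k * ψ q k
  have hψ : ∀ l, 0 < l → Tendsto (ψ l) atBot (𝓝 0) := fun l hl =>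
    tendsto_exp_mul_atBot (sub_pos.2 (ht hl))
  have hψp := hψ p hp0
  have hψq := hψ q (hp0.trans hpq)
  have hA : Tendsto A atBot (𝓝 (T 0 - M)) := by
    have := (tendsto_const_nhds (x := T 0 - M)).div (hψq.const_sub 1) (by simp)
    rwa [sub_zero, div_one] at this
  have he : Tendsto e atBot (𝓝 ((M - m) / 2)) := by
    simpa using ((hA.mul (hψp.sub hψq)).div_const 2).const_add ((M - m) / 2)
  have hB : Tendsto B atBot (𝓝 ((M + m) / 2)) := by
    have := (he.const_sub M).sub (hA.mul hψq)
    convert this using 2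
    ring
  let v : ℝ → Fin (n + 1) → ℝ := fun k l => A k * ψ l k + B k
  have hvlim : ∀ l, l ≠ 0 → Tendsto (fun k => v k l) atBot (𝓝 ((M + m) / 2)) := fun l hl => by
    simpa using (hA.mul (hψ l (Fin.pos_iff_ne_zero.2 hl))).add hB
  have hψq1 : ∀ k < 0, ψ q k < 1 := fun k hk => by
    simpa [ψ] using mul_neg_of_neg_of_pos hk (sub_pos.2 (ht (hp0.trans hpq)))
  have hv0 : ∀ k < 0, T 0 - v k 0 = e k := fun k hk => by
    have h1 : A k * (1 - ψ q k) = T 0 - M := div_mul_cancel₀ _ (by linarith [hψq1 k hk])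
    have h2 : ψ 0 k = 1 := by simp [ψ]
    simp only [v, B, h2]
    linarith
  have hvp : ∀ k, v k p - m = e k := fun k => by
    simp only [v, B, e]; ring
  have hvq : ∀ k, M - v k q = e k := fun k => by
    simp only [v, B]; ring
  have hAB : ∀ k l, v k l = expVec t (A k * Real.exp (-(k * t 0))) k (B k) l := fun k l => by
    simp only [v, expVec, ψ]
    rw [mul_assoc, ← Real.exp_add]
    ring_nf
  have hApos : ∀ k < 0, 0 < A k := fun k hk =>
    div_pos (by linarith) (by linarith [hψq1 k hk])
  have hmono : ∀ k < 0, ∀ x y, x < y → v k y < v k x := fun k hk x y hxy => by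
    rw [hAB, hAB]
    exact exp_curve_lt_of_lt (mul_neg_of_pos_of_neg (mul_pos (hApos k hk) (Real.exp_pos _)) hk)
      (ht hxy)
  have hepos : ∀ k < 0, (M - m) / 2 < e k := fun k hk => by
    have := hmono k hk p q hpq
    linarith [hvp k, hvq k]
  have hsmall : ∀ᶠ k in atBot, ∀ l, |T l - v k l| ≤ e k := by
    refine eventually_all.2 fun l => ?_
    rcases eq_or_ne l 0 with rfl | hl
    · filter_upwards [eventually_lt_atBot 0] with k hk
      rw [hv0 k hk, abs_of_pos]
      linarith [hepos k hk]
    have h1 : ∀ᶠ k in atBot, T l - v k l ≤ e k := by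
      rcases le_or_gt l q with h | h
      · filter_upwards [eventually_lt_atBot 0] with k hk
        have : v k q ≤ v k l := by
          rcases h.eq_or_lt with rfl | h
          · exact le_rfl
          · exact (hmono k hk _ _ h).le
        linarith [hvq k, (hrange l hl).2]
      · have hlt : T l < M := lt_of_le_of_ne (hrange l hl).2 fun h' => (hqmax l h').not_gt h
        filter_upwards [(hvlim l hl).eventually_const_lt
          (show T l - (M - m) / 2 < (M + m) / 2 by linarith), eventually_lt_atBot 0] with k h1 hk
        linarith [hepos k hk]
    have h2 : ∀ᶠ k in atBot, v k l - T l ≤ e k := by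
      rcases le_or_gt p l with h | h
      · filter_upwards [eventually_lt_atBot 0] with k hk
        have : v k l ≤ v k p := by
          rcases h.eq_or_lt with rfl | h
          · exact le_rfl
          · exact (hmono k hk _ _ h).le
        linarith [hvp k, (hrange l hl).1]
      · have hlt : m < T l := lt_of_le_of_ne (hrange l hl).1 fun h' => (hpmin l h'.symm).not_gt h
        filter_upwards [(hvlim l hl).eventually_lt_const
          (show (M + m) / 2 < T l + (M - m) / 2 by linarith), eventually_lt_atBot 0] with k h1 hk
        linarith [hepos k hk]
    filter_upwards [h1, h2] with k h1 h2
    exact abs_le.2 ⟨by linarith, h1⟩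
  have heq : ∀ᶠ k in atBot, v k = expVec t (a k) k (b k) := by
    filter_upwards [hsmall, eventually_lt_atBot 0] with k hs hk
    have hve : error T (expVec t (A k * Real.exp (-(k * t 0))) k (B k)) ≤ e k := by
      refine error_le (by linarith [hepos k hk]) fun l => ?_
      rw [← hAB]
      exact hs l
    have hf := fun l => abs_le.1 ((abs_le_error T (expVec t (a k) k (b k)) l).trans
      ((hab k hk _ _).trans hve))
    have f0 := (hf 0).2
    have fp := (hf p).1
    have fq := (hf q).2
    rw [← hv0 k hk] at f0
    have gp := hvp k
    have gq := hvq k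
    have hdiff : ∀ l, (a k - A k * Real.exp (-(k * t 0))) * Real.exp (k * t l) +
        (b k - B k) = expVec t (a k) k (b k) l - v k l := fun l => by
      rw [hAB]; simp only [expVec]; ring
    -- The best curve minus `v k` is `≥ 0`, `≤ 0`, `≥ 0` at `0`, `p`, `q`. It is a multiple of `exp
    -- (k s)` plus a constant, hence strictly monotone unless the multiple vanishes; then the
    -- constant vanishes too.
    have hzero : a k - A k * Real.exp (-(k * t 0)) = 0 := by
      by_contra hne
      rcases (mul_ne_zero hne hk.ne).lt_or_gt with h | h
      · have := exp_curve_lt_of_lt (b := b k - B k) h (ht hpq)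
        rw [hdiff, hdiff] at this
        linarith
      · have := exp_curve_lt_of_lt (a := -(a k - A k * Real.exp (-(k * t 0)))) (k := k)
          (b := -(b k - B k)) (by linarith) (ht hp0)
        have h1 := hdiff 0
        have h2 := hdiff p
        linarith
    have hd0 := hdiff 0
    have hdp := hdiff p
    rw [hzero, zero_mul, zero_add] at hd0 hdp
    have hdq := hdiff q
    rw [hzero, zero_mul, zero_add] at hdq
    ext l
    have hdl := hdiff l
    rw [hzero, zero_mul, zero_add] at hdl
    linarith
  refine Tendsto.congr' heq (tendsto_pi_nhds.2 fun l => ?_)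
  rcases eq_or_ne l 0 with rfl | hl
  · simp only [if_true]
    refine (he.const_sub (T 0)).congr' ?_
    filter_upwards [eventually_lt_atBot 0] with k hk
    linarith [hv0 k hk]
  · simpa [hl] using hvlim l hl

/-! ### Extreme values of the data, error bounds and strictness. -/

theorem le_maxVal {n : ℕ} (T : Fin (n + 1) → ℝ) (l : Fin (n + 1)) : T l ≤ maxVal T :=
  le_ciSup (Set.finite_range T).bddAbove l

theorem minVal_le {n : ℕ} (T : Fin (n + 1) → ℝ) (l : Fin (n + 1)) : minVal T ≤ T l :=
  ciInf_le (Set.finite_range T).bddBelow l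

theorem exists_eq_minVal {n : ℕ} (T : Fin (n + 1) → ℝ) : ∃ p, T p = minVal T :=
  exists_eq_ciInf_of_finite

theorem le_secondVal {n : ℕ} (T : Fin (n + 1) → ℝ) {l : Fin (n + 1)} (hl : l ≠ 0) :
    T l ≤ secondVal T := by
  obtain ⟨l, rfl⟩ := Fin.exists_succ_eq.2 hl
  exact le_ciSup (f := fun i : Fin n => T i.succ) (Set.finite_range _).bddAbove l

theorem exists_eq_secondVal {n : ℕ} (T : Fin (n + 1) → ℝ) (hn : 0 < n) :
    ∃ q, q ≠ 0 ∧ T q = secondVal T := by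
  have : Nonempty (Fin n) := ⟨⟨0, hn⟩⟩
  obtain ⟨q, hq⟩ := exists_eq_ciSup_of_finite (f := fun i : Fin n => T i.succ)
  exact ⟨q.succ, Fin.succ_ne_zero q, hq⟩

/-- A decreasing vector has error greater than half of any increase of the data. -/
theorem half_sub_lt_error {ι : Type*} [Fintype ι] {T v : ι → ℝ} {p q : ι} (h : v q < v p) :
    (T q - T p) / 2 < error T v := by
  have h1 := (abs_le.1 (abs_le_error T v p)).1
  have h2 := (abs_le.1 (abs_le_error T v q)).2
  linarith

theorem error_const_le {ι : Type*} [Fintype ι] [Nonempty ι] {t T : ι → ℝ} {m M : ℝ}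
    (h : ∀ l, m ≤ T l ∧ T l ≤ M) : error T (lineVec t 0 ((M + m) / 2)) ≤ (M - m) / 2 := by
  have h0 := h (Classical.arbitrary ι)
  refine error_le (by linarith) fun l => ?_
  have := h l
  simp only [lineVec, zero_mul, zero_add]
  rw [abs_le]
  constructor <;> linarith

theorem error_limitVec_le {n : ℕ} (T : Fin (n + 1) → ℝ) (h : minVal T ≤ secondVal T) :
    error T (limitVec T) ≤ (secondVal T - minVal T) / 2 := by
  refine error_le (by linarith) fun l => ?_
  rcases eq_or_ne l 0 with rfl | hl
  · simp only [limitVec, if_true, sub_sub_cancel]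
    rw [abs_of_nonneg (by linarith)]
  · have h1 := le_secondVal T hl
    have h2 := minVal_le T l
    simp only [limitVec, hl, if_false]
    rw [abs_le]
    constructor <;> linarith

theorem half_sub_le_error_step {n : ℕ} {T : Fin (n + 1) → ℝ} {p q : Fin (n + 1)} (hp : p ≠ 0)
    (hq : q ≠ 0) (x y : ℝ) : (T q - T p) / 2 ≤ error T (fun l => if l = 0 then x else y) := by
  have h1 := (abs_le.1 (abs_le_error T (fun l => if l = 0 then x else y) p)).1
  have h2 := (abs_le.1 (abs_le_error T (fun l => if l = 0 then x else y) q)).2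
  simp only [hp, hq, if_false] at h1 h2
  linarith

theorem IsBestApprox.error_le {ι : Type*} [Fintype ι] {t T : ι → ℝ} {a k b : ℝ}
    (h : IsBestApprox t T a k b) (a' k' b' : ℝ) :
    error T (expVec t a k b) ≤ error T (expVec t a' k' b') := by
  by_cases heq : (fun s : ℝ => a' * Real.exp (k' * s) + b') = fun s => a * Real.exp (k * s) + b
  · have : expVec t a' k' b' = expVec t a k b := funext fun l => congrFun heq (t l)
    rw [this]
  · exact (h a' k' b' heq).le

/-- A minimizer of the error is a strict minimizer. -/
theorem isBestApprox_of_forall_error_le {n : ℕ} {t T : Fin (n + 1) → ℝ} (ht : StrictMono t)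
    {i j m : Fin (n + 1)} (hij : i < j) (hjm : j < m) {E a k b : ℝ}
    (hneg : ∀ a' k' b' : ℝ, error T (expVec t a' k' b') ≤ E → k' < 0 ∧ 0 < a')
    (hE : error T (expVec t a k b) ≤ E)
    (hmin : ∀ a' k' b' : ℝ, error T (expVec t a k b) ≤ error T (expVec t a' k' b')) :
    IsBestApprox t T a k b := by
  intro a' k' b' hne
  by_contra! hle
  obtain ⟨hk, ha⟩ := hneg a k b hE
  obtain ⟨hk', ha'⟩ := hneg a' k' b' (hle.trans hE)
  rcases lt_trichotomy k k' with h | rfl | h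
  · obtain ⟨a₂, k₂, b₂, h₂⟩ := exists_error_lt_of_exponent_lt ht hij hjm ha ha' h hk' hle
    exact (hmin a₂ k₂ b₂).not_gt h₂
  · have : Nontrivial (Fin (n + 1)) := ⟨i, j, hij.ne⟩
    obtain ⟨rfl, rfl⟩ := IsBestFor.unique ht.injective hk.ne (fun a₂ b₂ => hmin a₂ k b₂)
      (fun a₂ b₂ => hle.trans (hmin a₂ k b₂) : IsBestFor t T k a' b')
    exact hne rfl
  · obtain ⟨a₂, k₂, b₂, h₂⟩ :=
      exists_error_lt_of_exponent_lt ht hij hjm ha' ha h hk (hmin a' k' b')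
    exact (hmin a₂ k₂ b₂).not_gt (h₂.trans_le hle)

end ExpFit

theorem mainTheorem1 {n : ℕ} (t T : Fin (n + 1) → ℝ) (ht : StrictMono t)
    (hadm : ExpFit.Admissible t T) :
    ((∃ a k b : ℝ, a ≠ 0 ∧ k ≠ 0 ∧ ExpFit.IsBestApprox t T a k b) ↔ ¬ ExpFit.Spade T) ∧
    (∀ k : ℝ, k ≠ 0 → ∃! p : ℝ × ℝ, ExpFit.IsBestFor t T k p.1 p.2) ∧
    (ExpFit.Spade T →
      (∀ a b : ℝ → ℝ, (∀ k < 0, ExpFit.IsBestFor t T k (a k) (b k)) →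
        Tendsto (fun k => ExpFit.expVec t (a k) k (b k)) atBot (𝓝 (ExpFit.limitVec T))) ∧
      ∀ a k b : ℝ,
        ExpFit.error T (ExpFit.limitVec T) < ExpFit.error T (ExpFit.expVec t a k b)) := by
  open ExpFit in
  obtain ⟨a, b, hbest, ha, i, j, m, hij, hjm, ⟨hi, hj, hm⟩, hout, hin⟩ := hadm
  have hr : ∀ l, |T l - (a * t l + b)| ≤ error T (lineVec t a b) := fun l =>
    abs_le_error T (lineVec t a b) l
  unfold IsBestLine at hbest
  have hdecr : ∀ {p q}, p < q → lineVec t a b q < lineVec t a b p := fun {p q} hpq => by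
    have := mul_lt_mul_of_neg_left (ht hpq) ha
    simp only [lineVec]
    linarith
  have hrise : ∀ {p q}, p < q → (T q - T p) / 2 < error T (lineVec t a b) := fun hpq =>
    half_sub_lt_error (hdecr hpq)
  generalize error T (lineVec t a b) = E at hbest hi hj hm hout hin hr hrise
  have hE : 0 < E := by linarith [(hin j hij hjm).2]
  have hn : 0 < n := by omega
  have hneg : ∀ a' k' b' : ℝ, error T (expVec t a' k' b') ≤ E → k' < 0 ∧ 0 < a' :=
    fun a' k' b' h => exponent_neg_of_error_le ha (ht hij) (ht hjm) hi hj hm h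
  obtain ⟨a₁, k₁, b₁, h₁⟩ : ∃ a k b : ℝ, error T (expVec t a k b) < E := by
    refine exists_exp_error_lt_line ha (ht hij) (ht hjm) hr (fun l hl => ?_) fun l h1 h2 => ?_
    · rw [ht.le_iff_le, ht.le_iff_le] at hl
      rcases hl with hl | hl <;> rcases hl.eq_or_lt with rfl | hl
      · linarith
      · exact (hout l (Or.inl hl)).2
      · linarith
      · exact (hout l (Or.inr hl)).2
    · exact (hin l (ht.lt_iff_lt.1 h1) (ht.lt_iff_lt.1 h2)).2
  have hk₁ := (hneg _ _ _ h₁.le).1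
  -- This keeps the minimum away from the first index, so it is one of the entries that a vector
  -- `(x, y, …, y)` must fit with the single value `y`.
  have hj0 : T j < T 0 := by
    have h0j : lineVec t a b j < lineVec t a b 0 := hdecr ((Fin.zero_le i).trans_lt hij)
    simp only [lineVec] at h0j
    rcases (Fin.zero_le i).eq_or_lt with h | h
    · rw [← h] at hi
      linarith
    · linarith [(hout 0 (Or.inl h)).2]
  have hp0 : ∀ p, T p = minVal T → p ≠ 0 := by
    rintro p hp rfl
    linarith [minVal_le T j]
  obtain ⟨p, hp⟩ := exists_eq_minVal T
  obtain ⟨q, hq0, hq⟩ := exists_eq_secondVal T hn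
  have hmM : minVal T ≤ secondVal T := hq ▸ minVal_le T q
  have hrange : ∀ l, l ≠ 0 → minVal T ≤ T l ∧ T l ≤ secondVal T := fun l hl =>
    ⟨minVal_le T l, le_secondVal T hl⟩
  -- The horizontal line at mid-range competes with the best line.
  have hconst : T 0 ≤ secondVal T → E ≤ (secondVal T - minVal T) / 2 := fun h0 =>
    (hbest 0 _).trans (error_const_le fun l => by
      rcases eq_or_ne l 0 with rfl | hl
      · exact ⟨minVal_le T 0, h0⟩
      · exact hrange l hl)
  have hspade : Spade T → (secondVal T - minVal T) / 2 < E ∧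
      ∀ a k b : ℝ, (secondVal T - minVal T) / 2 < error T (expVec t a k b) := by
    rintro ⟨-, p, q, hpq, hp, hq⟩
    rw [← hp, ← hq]
    refine ⟨hrise hpq, fun a k b => ?_⟩
    by_contra! hle
    obtain ⟨hk, ha⟩ := hneg a k b (hle.trans (hrise hpq).le)
    exact hle.not_gt (half_sub_lt_error
      (exp_curve_lt_of_lt (mul_neg_of_pos_of_neg ha hk) (ht hpq)))
  have hlim : Spade T → ∀ a b : ℝ → ℝ, (∀ k < 0, IsBestFor t T k (a k) (b k)) →
      Tendsto (fun k => expVec t (a k) k (b k)) atBot (𝓝 (limitVec T)) := by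
    intro hs a b hab
    have h0 : secondVal T < T 0 := by
      by_contra! h
      exact (hconst h).not_gt (hspade hs).1
    obtain ⟨-, p, q, hpq, hp, hq⟩ := hs
    exact tendsto_expVec_of_isBestFor ht h0 hmM hrange hp hq hpq hab
  have hlt : Spade T → ∀ a k b : ℝ, error T (limitVec T) < error T (expVec t a k b) :=
    fun hs a k b => (error_limitVec_le T hmM).trans_lt ((hspade hs).2 a k b)
  refine ⟨⟨?_, fun hs => ?_⟩, fun k hk => ?_, fun hs => ⟨hlim hs, hlt hs⟩⟩
  · rintro ⟨a₂, k₂, b₂, -, -, h₂⟩ hs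
    -- The errors of these curves tend to the error of `limitVec`, so one of them beats the supposed
    -- optimum.
    choose A B hAB using fun k => exists_isBestFor t T k
    have hA := ((continuous_error T).tendsto _).comp (hlim hs A B fun k _ => hAB k)
    obtain ⟨k, hk⟩ := (hA.eventually_lt_const (hlt hs a₂ k₂ b₂)).exists
    exact (h₂.error_le (A k) k (B k)).not_gt hk
  · obtain ⟨a₀, k₀, b₀, hk₀, h₀, hL⟩ : ∃ a k b : ℝ, k < 0 ∧ error T (expVec t a k b) < E ∧
        error T (expVec t a k b) < (secondVal T - minVal T) / 2 := by
      rcases le_or_gt (T 0) (secondVal T) with h0 | h0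
      · exact ⟨a₁, k₁, b₁, hk₁, h₁, h₁.trans_le (hconst h0)⟩
      have hmax : T 0 = maxVal T := by
        refine le_antisymm (le_maxVal T 0) (ciSup_le fun l => ?_)
        rcases eq_or_ne l 0 with rfl | hl
        · exact le_rfl
        · exact (le_secondVal T hl).trans h0.le
      have hpq : ∀ p q, T p = minVal T → T q = secondVal T → q ≤ p := by
        intro p q hp hq
        by_contra! h
        exact hs ⟨hmax, p, q, h, hp, hq⟩
      have hmM' : minVal T < secondVal T := by
        refine lt_of_le_of_ne hmM fun h => ?_
        have hc : ∀ l, l ≠ 0 → T l = secondVal T := fun l hl =>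
          le_antisymm (hrange l hl).2 (h ▸ (hrange l hl).1)
        have hj' : j ≠ 0 := ((Fin.zero_le i).trans_lt hij).ne'
        have hm' : m ≠ 0 := ((Fin.zero_le j).trans_lt hjm).ne'
        -- If all entries after the first were equal, `j < m` would already witness `Spade`.
        exact (hpq j m ((hc j hj').trans h.symm) (hc m hm')).not_gt hjm
      obtain ⟨a₂, k₂, b₂, hk₂, h₂⟩ := exists_error_lt_half_range ht h0 hmM' hrange hp hpq
      rcases le_total (error T (expVec t a₁ k₁ b₁)) (error T (expVec t a₂ k₂ b₂)) with h | h
      · exact ⟨a₁, k₁, b₁, hk₁, h₁, h.trans_lt h₂⟩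
      · exact ⟨a₂, k₂, b₂, hk₂, h.trans_lt h₁, h₂⟩
    obtain ⟨a', k', b', hE', hmin⟩ := exists_min_of_error_lt ht hn hk₀ h₀ hbest fun x y =>
      hL.trans_le (by simpa only [hp, hq] using half_sub_le_error_step (T := T) (hp0 p hp) hq0 x y)
    obtain ⟨hk', ha'⟩ := hneg _ _ _ hE'.le
    refine ⟨a', k', b', ha'.ne', hk'.ne,
      isBestApprox_of_forall_error_le ht hij hjm hneg hE'.le fun a₂ k₂ b₂ => ?_⟩
    rcases le_total (error T (expVec t a₂ k₂ b₂)) E with h | h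
    · exact hmin a₂ k₂ b₂ (hneg _ _ _ h).1
    · exact hE'.le.trans h
  · have : Nontrivial (Fin (n + 1)) := ⟨i, j, hij.ne⟩
    obtain ⟨A, B, hAB⟩ := exists_isBestFor t T k
    refine ⟨(A, B), hAB, fun w hw => ?_⟩
    obtain ⟨h1, h2⟩ := IsBestFor.unique ht.injective hk hw hAB
    exact Prod.ext h1 h2
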